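/- For a prime $p$ let $v_p$ denote the $p$-adic valuation on $\mathbb{Q}$, and for integers $0\le k\le n$ with $n\ge 1$ let $$H(n,k)=\sum_{1\le i_1<\cdots<i_k\le n}\frac{1}{i_1\cdots i_k}$$ be the $k$-th elementary symmetric function of $1,\frac12,\dots,\frac1n$ (with $H(n,0)=1$). A prime $p\ge 5$ is called regular if $v_p(B_l)=0$ for all even integers $l$ with $2\le l\le p-3$, where the Bernoulli numbers $B_n$ are defined by $\frac{x}{e^x-1}=\sum_{n\ge 0}B_n\frac{x^n}{n!}$. Let $p\ge 5$ be a regular prime and let $a$ and $k$ be integers such that $1\le a\le p-1$ and $\max\{1,a-2\}\le k\le ap-1$. Then $$v_p(H(ap-1,k))\le 4-a.$$ In particular, if $a\ge 5$ (so that $p\ge 7$ and $a-2\le k\le ap-1$), then $$v_p(H(ap-1,k))<-\frac{1}{2\log p}\,\log(ap-1),$$ in accordance with the conjecture of Leonetti and Sanna that for every prime $p$ and every integer $k\ge 1$ there is a constant $c=c(k,p)>0$ with $v_p(H(n,k))<-c\log n$ for all large $n$. -/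

import Mathlib

/-- A prime `p` is regular if `v_p (B_l) = 0` for all even integers `l` with `2 ≤ l ≤ p - 3`, where
`B_l` is the `l`-th Bernoulli number, `x / (e ^ x - 1) = ∑ B_n x ^ n / n!`.
(Bernoulli numbers of positive even index are nonzero, so the value of `padicValRat` at `0`
plays no role.) -/
def IsRegularPrime (p : ℕ) : Prop :=
  p.Prime ∧ ∀ l : ℕ, Even l → 2 ≤ l → l + 3 ≤ p → padicValRat p (bernoulli l) = 0

/-- `H(n, k)`, the `k`-th elementary symmetric function of `1, 1/2, …, 1/n`: the sum of
`1 / (i₁ ⋯ i_k)` over all `1 ≤ i₁ < ⋯ < i_k ≤ n`. In particular `H(n, 0) = 1`. -/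
def harmonicEsymm (n k : ℕ) : ℚ :=
  ∑ s ∈ (Finset.Icc 1 n).powersetCard k, ∏ i ∈ s, (1 / (i : ℚ))

/-! ### Products of consecutive linear factors modulo `p ^ 2` -/

section
open Polynomial

/-! With `n = a * p - 1`, `n! * H(n, k)` is the coefficient `g_k` of `X ^ k` in `(X + 1) ⋯ (X + n)`,
and `n!` has valuation `a - 1`; so the bound says `p ^ 4 ∤ g_k`.

If `k + 1 ≡ a (mod 2)`, already `p ^ 2 ∤ g_k` (`IsRegularPrime.not_sq_dvd_coeff_prod_range_mul`):
modulo `p ^ 2` the product over `a` blocks of length `p` is explicit in terms of one block, whose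
relevant coefficients are controlled by Bernoulli numbers through Newton's identities and
Faulhaber's formula.

For the other parity, the symmetry `X ↦ -X - a * p` expresses `2 * g_k` as `(k + 1) * g_{k+1} * a *
p` plus terms of higher order in `a * p`. Here `g_{k+1}` has the good parity, and the first term
cannot be cancelled modulo `p ^ 4` (`IsRegularPrime.not_pow_four_dvd_coeff`). -/

theorem ZMod.prod_range_X_add_C (p : ℕ) [Fact p.Prime] :
    ∏ i ∈ Finset.range p, (X + C (i : ZMod p)) = X ^ p - X := by
  have hp := (Fact.out : p.Prime)
  have h1 : ∏ a : ZMod p, (X - C a) = X ^ p - X := by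
    have hdeg := FiniteField.X_pow_card_sub_X_natDegree_eq (ZMod p) hp.one_lt
    have hroots := FiniteField.roots_X_pow_card_sub_X (ZMod p)
    rw [ZMod.card] at hroots
    have hm : (X ^ p - X : (ZMod p)[X]).Monic := by
      apply monic_X_pow_sub
      rw [degree_X]
      exact_mod_cast hp.one_lt
    have := prod_multiset_X_sub_C_of_monic_of_roots_card_eq hm (by
      rw [hroots, hdeg]; simp [ZMod.card])
    rw [hroots] at this
    exact this
  rw [← h1, ← Equiv.prod_comp (Equiv.neg (ZMod p))]
  refine Finset.prod_nbij' (fun i => (i : ZMod p)) ZMod.val ?_ ?_ ?_ ?_ ?_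
  · simp
  · intro a _; simpa using ZMod.val_lt a
  · intro a ha; exact ZMod.val_cast_of_lt (by simpa using ha)
  · simp
  · simp

theorem exists_prod_range_X_add_C_eq (p : ℕ) [Fact p.Prime] :
    ∃ h : ℤ[X], h.natDegree ≤ p ∧
      ∏ i ∈ Finset.range p, (X + C (i : ℤ)) = X ^ p - X + (p : ℤ[X]) * h := by
  have hp := (Fact.out : p.Prime)
  have hd : C (p : ℤ) ∣ ∏ i ∈ Finset.range p, (X + C (i : ℤ)) - (X ^ p - X) := by
    rw [C_dvd_iff_dvd_coeff]
    intro i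
    rw [← ZMod.intCast_zmod_eq_zero_iff_dvd]
    have h0 : (∏ i ∈ Finset.range p, (X + C (i : ℤ)) - (X ^ p - X)).map
        (Int.castRingHom (ZMod p)) = 0 := by
      simp only [Polynomial.map_sub, Polynomial.map_prod, Polynomial.map_add, Polynomial.map_pow,
        map_X, map_C, Int.coe_castRingHom, Int.cast_natCast, sub_eq_zero]
      exact ZMod.prod_range_X_add_C p
    simpa only [coeff_map, coeff_zero, eq_intCast] using congrArg (fun q => coeff q i) h0
  obtain ⟨h, hh⟩ := hd
  refine ⟨h, ?_, ?_⟩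
  · have hp0 : (p : ℤ) ≠ 0 := by exact_mod_cast hp.ne_zero
    rw [← natDegree_C_mul hp0, ← hh]
    refine (natDegree_sub_le _ _).trans (max_le ?_ ?_)
    · refine (natDegree_prod_le _ _).trans ?_
      refine (Finset.sum_le_card_nsmul _ _ 1 fun i _ => ?_).trans (by simp)
      exact natDegree_X_add_C _ |>.le
    · refine (natDegree_sub_le _ _).trans (max_le ?_ ?_)
      · simp
      · simpa using hp.one_le
  · have : (C (p : ℤ) : ℤ[X]) = (p : ℤ[X]) := by simp
    rw [← this, ← hh]; ring

/-- Modulo `p ^ 2` a shift by `i * p` changes neither `X ^ p` nor `p * h`; only `-X` moves, by `-i *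
p`. -/
theorem sq_dvd_comp_X_add_sub {p : ℕ} {f h : ℤ[X]}
    (hf : f = X ^ p - X + (p : ℤ[X]) * h) (i : ℕ) :
    (p : ℤ[X]) ^ 2 ∣ f.comp (X + C ((i * p : ℕ) : ℤ)) -
      (X ^ p - X + (p : ℤ[X]) * (h - C (i : ℤ))) := by
  have hC : (C ((i * p : ℕ) : ℤ) : ℤ[X]) = (i : ℤ[X]) * (p : ℤ[X]) := by simp
  have h1 : (p : ℤ[X]) ^ 2 ∣ (X + (i : ℤ[X]) * (p : ℤ[X])) ^ p - X ^ p := by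
    have := dvd_sub_pow_of_dvd_sub (R := ℤ[X]) (p := p) (a := X + (i : ℤ[X]) * (p : ℤ[X])) (b := X)
      ⟨(i : ℤ[X]), by ring⟩ 1
    simpa using this
  have h2 : (p : ℤ[X]) ∣ h.comp (X + (i : ℤ[X]) * (p : ℤ[X])) - h := by
    have := sub_dvd_eval_sub (X + (i : ℤ[X]) * (p : ℤ[X])) X (h.map C)
    rw [eval_map, eval_map] at this
    have hX : eval₂ C X h = h := by exact eval₂_C_X
    rw [hX] at this
    exact (Dvd.intro_left (i : ℤ[X]) (by ring)).trans this
  obtain ⟨u, hu⟩ := h1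
  obtain ⟨v, hv⟩ := h2
  rw [hC, hf]
  simp only [add_comp, sub_comp, mul_comp, pow_comp, X_comp, natCast_comp]
  refine ⟨u + v, ?_⟩
  have hu' := sub_eq_iff_eq_add.1 hu
  have hv' := sub_eq_iff_eq_add.1 hv
  rw [hu', hv']
  simp only [map_natCast]
  ring

theorem exists_sq_dvd_prod_range_mul_sub {p : ℕ} {h : ℤ[X]}
    (hf : ∏ i ∈ Finset.range p, (X + C (i : ℤ)) = X ^ p - X + (p : ℤ[X]) * h) (b : ℕ) :
    ∃ c : ℤ, (p : ℤ[X]) ^ 2 ∣ ∏ i ∈ Finset.range ((b + 1) * p), (X + C (i : ℤ)) -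
      ((X ^ p - X) ^ (b + 1) +
        (p : ℤ[X]) * ((X ^ p - X) ^ b * (C ((b : ℤ) + 1) * h - C c))) := by
  induction b with
  | zero => exact ⟨0, 0, by rw [zero_add, one_mul, hf]; simp⟩
  | succ b ih =>
    obtain ⟨c, u, hu⟩ := ih
    obtain ⟨v, hv⟩ := sq_dvd_comp_X_add_sub hf (b + 1)
    have hsplit : ∏ i ∈ Finset.range ((b + 1 + 1) * p), (X + C (i : ℤ)) =
        (∏ i ∈ Finset.range ((b + 1) * p), (X + C (i : ℤ))) *
        (∏ i ∈ Finset.range p, (X + C (i : ℤ))).comp (X + C (((b + 1) * p : ℕ) : ℤ)) := by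
      rw [add_mul (b + 1) 1 p, one_mul, Finset.prod_range_add, Polynomial.prod_comp]
      congr 1
      refine Finset.prod_congr rfl fun i _ => ?_
      simp only [add_comp, X_comp, C_comp]
      push_cast
      simp only [C_add]
      ring
    -- Block `i` contributes `T + p * (h - i)` with `T = X ^ p - X`, so `c` is the sum of the block
    -- indices.
    refine ⟨c + (b + 1), ?_⟩
    rw [hsplit, sub_eq_iff_eq_add.1 hu, sub_eq_iff_eq_add.1 hv]
    generalize (X ^ p - X : ℤ[X]) = T
    simp only [C_add, map_natCast, Nat.cast_add, Nat.cast_one, map_one]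
    refine ⟨u * (T + p * (h - (b + 1))) + v * (p ^ 2 * u + (T ^ (b + 1) +
      p * (T ^ b * ((b + 1) * h - C c)))) + T ^ b * ((b + 1) * h - C c) * (h - (b + 1)), ?_⟩
    ring

/-- The exponents in `(X ^ (q + 1) - X) ^ b` are `b + q * l`, all in one class modulo `q`, so a
single binomial term meets the coefficient of `Q` at `r`. -/
theorem coeff_X_pow_sub_X_pow_mul {q b r m : ℕ} {Q : ℤ[X]} (hq : 0 < q)
    (hQ : ∀ i, i ≡ r [MOD q] → i ≠ r → Q.coeff i = 0) :
    ((X ^ (q + 1) - X) ^ b * Q).coeff (b + q * m + r) =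
      (-1) ^ (b - m) * (b.choose m : ℤ) * Q.coeff r := by
  rw [sub_eq_add_neg, add_pow, Finset.sum_mul, finsetSum_coeff]
  have key : ∀ l ∈ Finset.range (b + 1),
      ((X ^ (q + 1)) ^ l * (-X) ^ (b - l) * ((b.choose l : ℕ) : ℤ[X]) * Q).coeff (b + q * m + r) =
      (-1) ^ (b - l) * (b.choose l : ℤ) * (X ^ (b + q * l) * Q).coeff (b + q * m + r) := by
    intro l hl
    have hl : l ≤ b := by simpa [Nat.lt_succ_iff] using hl
    have : (X ^ (q + 1)) ^ l * (-X) ^ (b - l) * ((b.choose l : ℕ) : ℤ[X]) * Q =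
        C ((-1) ^ (b - l) * (b.choose l : ℤ)) * (X ^ (b + q * l) * Q) := by
      have e : b + q * l = (q + 1) * l + (b - l) := by rw [add_mul]; omega
      rw [e, pow_add X ((q + 1) * l), pow_mul, neg_pow (X : ℤ[X])]
      simp only [C_mul, C_pow, C_neg, map_one, map_natCast]
      ring
    rw [this, coeff_C_mul]
  rw [Finset.sum_congr rfl key, Finset.sum_eq_single m]
  · rw [add_comm (b + q * m) r, coeff_X_pow_mul]
  · intro l _ hlm
    rw [coeff_X_pow_mul']
    split_ifs with hle
    · rw [hQ, mul_zero]
      · have e : b + q * m + r - (b + q * l) + q * l = r + q * m := by omega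
        have : (b + q * m + r - (b + q * l) + q * l) ≡ (r + q * m) [MOD q] := by rw [e]
        simpa [Nat.ModEq] using this
      · intro h
        apply hlm
        have : q * m = q * l := by omega
        exact (Nat.eq_of_mul_eq_mul_left hq this).symm
    · simp
  · intro hm
    rw [Nat.choose_eq_zero_of_lt (by simpa using hm)]
    simp

end

/-! ### Bernoulli numbers and power sums -/

/-- Euler's formula for `ζ(2k)` and `ζ(2k) ≠ 0`. Needed because `padicValRat p 0 = 0`, so valuation
zero alone does not make a number a unit. -/
theorem bernoulli_two_mul_ne_zero {k : ℕ} (hk : k ≠ 0) : bernoulli (2 * k) ≠ 0 := by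
  intro h
  have hz := riemannZeta_two_mul_nat hk
  rw [h] at hz
  refine riemannZeta_ne_zero_of_one_lt_re (s := 2 * k) ?_ (by simpa using hz)
  have : (1 : ℝ) ≤ k := by exact_mod_cast Nat.one_le_iff_ne_zero.2 hk
  simp
  linarith

/-- The rational numbers that are integral at `p`, as a subring of `ℚ`. -/
noncomputable def Rat.integersAt (p : ℕ) [Fact p.Prime] : Subring ℚ :=
  (PadicInt.subring p).comap (Rat.castHom ℚ_[p])

theorem Rat.mem_integersAt {p : ℕ} [Fact p.Prime] {x : ℚ} :
    x ∈ Rat.integersAt p ↔ ‖(x : ℚ_[p])‖ ≤ 1 := Iff.rfl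

theorem Rat.inv_natCast_mem_integersAt {p : ℕ} [Fact p.Prime] {n : ℕ} (hn : ¬ p ∣ n) :
    (n : ℚ)⁻¹ ∈ Rat.integersAt p := by
  rw [Rat.mem_integersAt]
  push_cast
  rw [norm_inv, Padic.norm_natCast_eq_one_iff.2, inv_one]
  exact (Nat.Prime.coprime_iff_not_dvd Fact.out).2 hn

/-- Solving the recurrence for `B_j` divides only by `j + 1 < p`. -/
theorem bernoulli_mem_integersAt {p : ℕ} [Fact p.Prime] (j : ℕ) (hj : j + 2 ≤ p) :
    bernoulli j ∈ Rat.integersAt p := by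
  induction j using Nat.strong_induction_on with
  | _ j ih =>
    have h := sum_bernoulli (j + 1)
    rw [Finset.sum_range_succ, Nat.choose_succ_self_right] at h
    have hj0 : ((j + 1 : ℕ) : ℚ) ≠ 0 := by exact_mod_cast j.succ_ne_zero
    have e : bernoulli j = ((j + 1 : ℕ) : ℚ)⁻¹ * ((if j + 1 = 1 then 1 else 0) -
        ∑ k ∈ Finset.range j, ((j + 1).choose k : ℚ) * bernoulli k) := by
      rw [← h]; field_simp; ring
    rw [e]
    refine mul_mem (Rat.inv_natCast_mem_integersAt fun hd => ?_) (sub_mem ?_ (sum_mem fun k hk => ?_))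
    · have := Nat.le_of_dvd j.succ_pos hd
      omega
    · split_ifs
      exacts [one_mem _, zero_mem _]
    · have := Finset.mem_range.1 hk
      exact mul_mem (natCast_mem _ _) (ih k this (by omega))

/-- By Faulhaber's formula the sum is `p * B_m` plus `p ^ 2` times a `p`-integral number, and `B_m`
is a `p`-adic unit. -/
theorem IsRegularPrime.not_sq_dvd_sum_pow {p m : ℕ} (hp : IsRegularPrime p) (hm : Even m)
    (hm2 : 2 ≤ m) (hmp : m + 3 ≤ p) :
    ¬ (p : ℤ) ^ 2 ∣ ∑ i ∈ Finset.range p, (i : ℤ) ^ m := by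
  have : Fact p.Prime := ⟨hp.1⟩
  rintro ⟨s, hs⟩
  have hs : ∑ i ∈ Finset.range p, (i : ℚ) ^ m = (p : ℚ) ^ 2 * s := by exact_mod_cast hs
  have hp0 : (p : ℚ) ≠ 0 := by exact_mod_cast hp.1.ne_zero
  rw [sum_range_pow, Finset.sum_range_succ] at hs
  set r : ℚ := s - ∑ j ∈ Finset.range m,
    bernoulli j * ((m + 1).choose j : ℚ) * (p : ℚ) ^ (m - 1 - j) * ((m + 1 : ℕ) : ℚ)⁻¹ with hr
  have hsum : ∑ j ∈ Finset.range m,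
      bernoulli j * ((m + 1).choose j : ℚ) * (p : ℚ) ^ (m + 1 - j) / ((m : ℚ) + 1) =
      (p : ℚ) ^ 2 * ∑ j ∈ Finset.range m,
        bernoulli j * ((m + 1).choose j : ℚ) * (p : ℚ) ^ (m - 1 - j) * ((m + 1 : ℕ) : ℚ)⁻¹ := by
    rw [Finset.mul_sum]
    refine Finset.sum_congr rfl fun j hj => ?_
    have := Finset.mem_range.1 hj
    rw [show m + 1 - j = 2 + (m - 1 - j) by omega, pow_add]
    push_cast
    ring
  have hm1 : (m : ℚ) + 1 ≠ 0 := by positivity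
  have hB : bernoulli m = p * r := by
    rw [hsum, Nat.choose_succ_self_right, show m + 1 - m = 1 by omega, pow_one] at hs
    have h1 : bernoulli m * ((m + 1 : ℕ) : ℚ) * p / ((m : ℚ) + 1) = p * bernoulli m := by
      push_cast; field_simp
    rw [h1] at hs
    apply mul_left_cancel₀ hp0
    rw [hr]
    linear_combination hs
  have hrm : r ∈ Rat.integersAt p := by
    refine sub_mem (intCast_mem _ _) (sum_mem fun j hj => ?_)
    have := Finset.mem_range.1 hj
    refine mul_mem (mul_mem (mul_mem (bernoulli_mem_integersAt j (by omega)) (natCast_mem _ _))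
      (pow_mem (natCast_mem _ _) _)) (Rat.inv_natCast_mem_integersAt fun hd => ?_)
    have := Nat.le_of_dvd m.succ_pos hd
    omega
  have hB0 : bernoulli m ≠ 0 := by
    obtain ⟨k, rfl⟩ := hm
    rw [← two_mul]
    exact bernoulli_two_mul_ne_zero (by omega)
  have hnorm : ‖((bernoulli m : ℚ) : ℚ_[p])‖ = 1 := by
    rw [Padic.eq_padicNorm, padicNorm.eq_zpow_of_nonzero hB0, hp.2 m hm hm2 hmp]
    simp
  rw [hB] at hnorm
  push_cast at hnorm
  rw [norm_mul] at hnorm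
  have h1 : ‖(p : ℚ_[p])‖ < 1 := Padic.norm_p_lt_one
  have h2 := Rat.mem_integersAt.1 hrm
  nlinarith [norm_nonneg (p : ℚ_[p]), norm_nonneg (r : ℚ_[p])]

/-! ### Coefficients of the good parity -/

section
open Polynomial

theorem dvd_sum_range_pow {p i : ℕ} [Fact p.Prime] (hi : i < p - 1) :
    (p : ℤ) ∣ ∑ x ∈ Finset.range p, (x : ℤ) ^ i := by
  rw [← ZMod.intCast_zmod_eq_zero_iff_dvd]
  have h := FiniteField.sum_pow_lt_card_sub_one (ZMod p) i (by rwa [ZMod.card])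
  push_cast
  rw [← h]
  refine Finset.sum_nbij' (fun i => (i : ZMod p)) ZMod.val ?_ ?_ ?_ ?_ ?_
  · simp
  · intro a _; simpa using ZMod.val_lt a
  · intro a ha; exact ZMod.val_cast_of_lt (by simpa using ha)
  · simp
  · simp

/-- Newton's identities for `0, 1, …, n - 1`. -/
theorem mul_coeff_prod_range_X_add_C {n m : ℕ} (hm : m ≤ n) :
    (m : ℤ) * (∏ i ∈ Finset.range n, (X + C (i : ℤ))).coeff (n - m) =
      (-1) ^ (m + 1) * ∑ a ∈ Finset.HasAntidiagonal.antidiagonal m with a.1 < m,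
        (-1) ^ a.1 * (∏ i ∈ Finset.range n, (X + C (i : ℤ))).coeff (n - a.1) *
          ∑ i ∈ Finset.range n, (i : ℤ) ^ a.2 := by
  have hE : ∀ l ≤ n, MvPolynomial.aeval (fun i : Fin n => ((i : ℕ) : ℤ))
      (MvPolynomial.esymm (Fin n) ℤ l) =
      (∏ i ∈ Finset.range n, (X + C (i : ℤ))).coeff (n - l) := by
    intro l hl
    rw [← Fin.prod_univ_eq_prod_range (fun i => (X + C (i : ℤ) : ℤ[X])),
      Finset.prod_X_add_C_coeff _ _ (by simp)]
    simp [MvPolynomial.esymm, Nat.sub_sub_self hl]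
  have hS : ∀ l, MvPolynomial.aeval (fun i : Fin n => ((i : ℕ) : ℤ))
      (MvPolynomial.psum (Fin n) ℤ l) = ∑ i ∈ Finset.range n, (i : ℤ) ^ l := by
    intro l
    rw [← Fin.sum_univ_eq_sum_range (fun i => (i : ℤ) ^ l)]
    simp [MvPolynomial.psum]
  have h := congrArg (MvPolynomial.aeval (fun i : Fin n => ((i : ℕ) : ℤ)))
    (MvPolynomial.mul_esymm_eq_sum (Fin n) ℤ m)
  simp only [map_mul, map_natCast, map_pow, map_neg, map_one, map_sum, hS] at h
  rw [hE m hm] at h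
  rw [h]
  congr 1
  refine Finset.sum_congr rfl fun a ha => ?_
  rw [hE]
  have := (Finset.mem_filter.1 ha).2
  omega

/-- In Newton's identity for `m = p - r`, each mixed term is a coefficient times a power sum, both
divisible by `p`. Modulo `p ^ 2` only the power sum of exponent `m` survives. -/
theorem IsRegularPrime.not_sq_dvd_coeff_prod_range {p r : ℕ} (hp : IsRegularPrime p) (hr : Odd r)
    (hr3 : 3 ≤ r) (hrp : r + 2 ≤ p) :
    ¬ (p : ℤ) ^ 2 ∣ (∏ i ∈ Finset.range p, (X + C (i : ℤ))).coeff r := by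
  have : Fact p.Prime := ⟨hp.1⟩
  intro hd
  have hodd : Odd p := hp.1.odd_of_ne_two (by omega)
  obtain ⟨m, rfl⟩ : ∃ m, r = p - m := ⟨p - r, by omega⟩
  have hm : Even m := by
    have := Nat.Odd.sub_odd hodd hr
    rwa [show p - (p - m) = m by omega] at this
  have hN := mul_coeff_prod_range_X_add_C (n := p) (m := m) (by omega)
  obtain ⟨h, -, hf⟩ := exists_prod_range_X_add_C_eq p
  have hcoeff : ∀ l, 0 < l → l < m →
      (p : ℤ) ∣ (∏ i ∈ Finset.range p, (X + C (i : ℤ))).coeff (p - l) := by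
    intro l h0 hl
    rw [hf, coeff_add, coeff_sub, coeff_X_pow, coeff_X, if_neg (by omega), if_neg (by omega)]
    exact ⟨h.coeff (p - l), by rw [← C_eq_natCast, coeff_C_mul]; simp⟩
  have hone : (∏ i ∈ Finset.range p, (X + C (i : ℤ))).coeff p = 1 := by
    have := Finset.prod_X_add_C_coeff (Finset.range p) (fun i => (i : ℤ)) (k := p) (by simp)
    simpa using this
  have hmem : ((0, m) : ℕ × ℕ) ∈ (Finset.HasAntidiagonal.antidiagonal m).filter (fun a => a.1 < m) := by
    simp; omega
  rw [← Finset.add_sum_erase _ _ hmem] at hN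
  simp only [pow_zero, one_mul, Nat.sub_zero, hone] at hN
  have hrest : (p : ℤ) ^ 2 ∣ ∑ a ∈ ((Finset.HasAntidiagonal.antidiagonal m).filter (fun a => a.1 < m)).erase (0, m),
      (-1) ^ a.1 * (∏ i ∈ Finset.range p, (X + C (i : ℤ))).coeff (p - a.1) *
        ∑ i ∈ Finset.range p, (i : ℤ) ^ a.2 := by
    refine Finset.dvd_sum fun a ha => ?_
    simp only [Finset.mem_erase, Finset.mem_filter, Finset.HasAntidiagonal.mem_antidiagonal, ne_eq,
      Prod.ext_iff] at ha
    rw [pow_two, mul_assoc]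
    refine (mul_dvd_mul (hcoeff a.1 (by omega) ha.2.2) (dvd_sum_range_pow (by omega))).mul_left _
  refine hp.not_sq_dvd_sum_pow hm (by omega) (by omega) ?_
  have h1 := hd.mul_left (m : ℤ)
  rw [hN] at h1
  rw [(isUnit_neg_one.pow _).dvd_mul_left] at h1
  exact (dvd_add_left hrest).1 h1

theorem Nat.Prime.not_dvd_choose_of_lt {p n m : ℕ} (hp : p.Prime) (hn : n < p) (hm : m ≤ n) :
    ¬ p ∣ n.choose m := fun h => by
  have h1 : p ∣ n.factorial := by
    rw [← Nat.choose_mul_factorial_mul_factorial hm, mul_assoc]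
    exact h.mul_right _
  exact absurd ((hp.dvd_factorial).1 h1) (not_le.2 hn)

/-- Write `j = a + (p - 1) * m + s` with `0 ≤ s < p - 1`; the parity condition makes `s` even. If `s
= 0`, the coefficient is `± a.choose m` modulo `p`. Otherwise it is `± p * (a - 1).choose m * a *
h_{s+1}` modulo `p ^ 2`, where `p * h_{s+1}` is a coefficient of a single block. -/
theorem IsRegularPrime.not_sq_dvd_coeff_prod_range_mul {p a j : ℕ} (hp : IsRegularPrime p)
    (hp5 : 5 ≤ p) (ha : 1 ≤ a) (hap : a < p) (haj : a ≤ j) (hj : j ≤ a * p) (hpar : Even (j - a)) :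
    ¬ (p : ℤ) ^ 2 ∣ (∏ i ∈ Finset.range (a * p), (X + C (i : ℤ))).coeff j := by
  have : Fact p.Prime := ⟨hp.1⟩
  have hodd : Odd p := hp.1.odd_of_ne_two (by omega)
  have hpZ : Prime (p : ℤ) := Nat.prime_iff_prime_int.1 hp.1
  have hp0 : (p : ℤ) ≠ 0 := hpZ.ne_zero
  obtain ⟨b, rfl⟩ : ∃ b, a = b + 1 := ⟨a - 1, by omega⟩
  obtain ⟨q, rfl⟩ : ∃ q, p = q + 1 := ⟨p - 1, by omega⟩
  have hq : Even q := by
    rcases Nat.even_or_odd q with h | h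
    · exact h
    · exact absurd hodd (Nat.not_odd_iff_even.2 h.add_one)
  have hq0 : 0 < q := by omega
  obtain ⟨h, hdeg, hf⟩ := exists_prod_range_X_add_C_eq (q + 1)
  obtain ⟨c, hc⟩ := exists_sq_dvd_prod_range_mul_sub hf b
  have hcoef : ((q + 1 : ℕ) : ℤ) ^ 2 ∣
      (∏ i ∈ Finset.range ((b + 1) * (q + 1)), (X + C (i : ℤ))).coeff j -
      (((X ^ (q + 1) - X) ^ (b + 1) * 1 : ℤ[X]).coeff j + ((q + 1 : ℕ) : ℤ) *
        ((X ^ (q + 1) - X) ^ b * (C ((b : ℤ) + 1) * h - C c)).coeff j) := by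
    have e : (((q + 1 : ℕ) : ℤ[X])) = C ((q + 1 : ℕ) : ℤ) := by simp only [C_eq_natCast]
    rw [e, ← C_pow, C_dvd_iff_dvd_coeff] at hc
    have := hc j
    rwa [coeff_sub, coeff_add, coeff_C_mul, ← mul_one ((X ^ (q + 1) - X) ^ (b + 1))] at this
  intro hd
  have hd' := (dvd_sub_right hd).1 hcoef
  set m := (j - (b + 1)) / q
  set s := (j - (b + 1)) % q with hs
  have hsq : s < q := Nat.mod_lt _ hq0
  have hjm : j = b + 1 + q * m + s := by
    have := Nat.div_add_mod (j - (b + 1)) q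
    change q * m + s = _ at this
    omega
  have hseven : Even s := by
    have h := hpar
    rw [← Nat.div_add_mod (j - (b + 1)) q, Nat.even_add] at h
    exact h.1 (hq.mul_right _)
  have hmle : q * m + s ≤ (b + 1) * q := by
    have : (b + 1) * (q + 1) = (b + 1) * q + (b + 1) := by ring
    omega
  have h1 : ((X ^ (q + 1) - X) ^ (b + 1) * 1 : ℤ[X]).coeff j =
      (-1) ^ (b + 1 - m) * ((b + 1).choose m : ℤ) * (1 : ℤ[X]).coeff s := by
    rw [hjm]
    refine coeff_X_pow_sub_X_pow_mul hq0 fun i hi his => ?_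
    rw [coeff_one, if_neg]
    rintro rfl
    rw [Nat.ModEq, Nat.zero_mod, Nat.mod_eq_of_lt hsq] at hi
    exact his hi
  have hunit : ∀ n : ℕ, IsUnit ((-1 : ℤ) ^ n) := fun n => isUnit_neg_one.pow n
  rw [h1] at hd'
  rcases Nat.eq_zero_or_pos s with hs0 | hs0
  · have hmb : m ≤ b + 1 := by
      have : q * m ≤ q * (b + 1) := by rw [mul_comm q (b + 1)]; omega
      exact Nat.le_of_mul_le_mul_left this hq0
    have h2 := (dvd_pow_self _ two_ne_zero).trans hd'
    rw [dvd_add_left (dvd_mul_right _ _), hs0, coeff_one_zero, mul_one,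
      (hunit _).dvd_mul_left] at h2
    exact hp.1.not_dvd_choose_of_lt hap hmb (by exact_mod_cast h2)
  · have hmb : m ≤ b := by
      have : q * m < q * (b + 1) := by rw [mul_comm q (b + 1)]; omega
      exact Nat.lt_succ_iff.1 (Nat.lt_of_mul_lt_mul_left this)
    have hs2 : 2 ≤ s := by
      obtain ⟨t, ht⟩ := hseven
      omega
    have hsq2 : s + 2 ≤ q := by
      obtain ⟨t, ht⟩ := hseven
      obtain ⟨u, hu⟩ := hq
      omega
    have h2 : ((X ^ (q + 1) - X) ^ b * (C ((b : ℤ) + 1) * h - C c)).coeff j =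
        (-1) ^ (b - m) * (b.choose m : ℤ) * (C ((b : ℤ) + 1) * h - C c).coeff (s + 1) := by
      rw [show j = b + q * m + (s + 1) by omega]
      refine coeff_X_pow_sub_X_pow_mul hq0 fun i hi his => ?_
      -- The next exponent congruent to `s + 1` is at least `s + 1 + q`, beyond the degree of `h`
      -- since `s > 0`.
      have hiq : q + 1 < i := by
        have hsq1 : s + 1 < q := by omega
        rw [Nat.ModEq, Nat.mod_eq_of_lt hsq1] at hi
        have h3 := Nat.div_add_mod i q
        have h4 : i / q ≠ 0 := by
          intro h0
          rw [h0, hi] at h3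
          omega
        have h5 : q * 1 ≤ q * (i / q) := Nat.mul_le_mul_left q (Nat.one_le_iff_ne_zero.2 h4)
        omega
      rw [coeff_sub, coeff_C_mul, coeff_C_of_ne_zero (by omega),
        coeff_eq_zero_of_natDegree_lt (lt_of_le_of_lt hdeg hiq)]
      simp
    rw [h2, coeff_one, if_neg (by omega), mul_zero, zero_add, pow_two,
      mul_dvd_mul_iff_left hp0, coeff_sub, coeff_C_mul, coeff_C_of_ne_zero (by omega), sub_zero,
      mul_assoc, (hunit _).dvd_mul_left] at hd'
    rcases hpZ.dvd_or_dvd hd' with h3 | h3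
    · exact hp.1.not_dvd_choose_of_lt (by omega) hmb (by exact_mod_cast h3)
    rcases hpZ.dvd_or_dvd h3 with h4 | h4
    · have h5 : q + 1 ∣ b + 1 := by exact_mod_cast h4
      have := Nat.le_of_dvd b.succ_pos h5
      omega
    · refine hp.not_sq_dvd_coeff_prod_range (r := s + 1) hseven.add_one (by omega) (by omega) ?_
      rw [hf, coeff_add, coeff_sub, coeff_X_pow, coeff_X, if_neg (by omega), if_neg (by omega),
        ← C_eq_natCast, coeff_C_mul, sub_zero, zero_add, pow_two]
      exact mul_dvd_mul_left _ h4

/-! ### The reflection symmetry and the other parity -/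

theorem X_mul_prod_range_X_add_C_succ (n : ℕ) :
    X * ∏ i ∈ Finset.range n, (X + C ((i : ℤ) + 1)) =
      ∏ i ∈ Finset.range (n + 1), (X + C (i : ℤ)) := by
  rw [Finset.prod_range_succ', mul_comm]
  simp

theorem Polynomial.exists_eval_eq_add_pow_four (D : ℤ[X]) (N : ℤ) :
    ∃ e, D.eval N = D.coeff 0 + D.coeff 1 * N + D.coeff 2 * N ^ 2 + D.coeff 3 * N ^ 3 +
      N ^ 4 * e := by
  have h : ∀ E : ℤ[X], E.eval N = E.divX.eval N * N + E.coeff 0 := fun E => by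
    conv_lhs => rw [← E.divX_mul_X_add]
    simp
  refine ⟨D.divX.divX.divX.divX.eval N, ?_⟩
  rw [h D, h D.divX, h D.divX.divX, h D.divX.divX.divX]
  simp only [coeff_divX]
  ring

/-- The symmetry `x ↦ -x - (n + 1)` of `(x + 1) ⋯ (x + n)`, read off the coefficients. -/
theorem exists_two_mul_coeff_prod_range_X_add_C_succ {n k : ℕ} (hnk : Odd (n + k)) :
    ∃ e : ℤ, 2 * (∏ i ∈ Finset.range n, (X + C ((i : ℤ) + 1))).coeff k =
      ((k + 1).choose k : ℤ) *
        (∏ i ∈ Finset.range n, (X + C ((i : ℤ) + 1))).coeff (k + 1) * (n + 1) -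
      ((k + 2).choose k : ℤ) *
        (∏ i ∈ Finset.range n, (X + C ((i : ℤ) + 1))).coeff (k + 2) * (n + 1) ^ 2 +
      ((k + 3).choose k : ℤ) *
        (∏ i ∈ Finset.range n, (X + C ((i : ℤ) + 1))).coeff (k + 3) * (n + 1) ^ 3 +
      (n + 1) ^ 4 * e := by
  set G : ℤ[X] := ∏ i ∈ Finset.range n, (X + C ((i : ℤ) + 1)) with hG
  have hco : ∀ j, (G.comp (C (-1) * X)).coeff j = G.coeff j * (-1) ^ j := fun j =>
    comp_C_mul_X_coeff
  have hsym : taylor ((n : ℤ) + 1) (G.comp (C (-1) * X)) = C ((-1) ^ n) * G := by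
    rw [taylor_apply, comp_assoc, hG, Polynomial.prod_comp]
    conv_rhs => rw [← Finset.prod_range_reflect, C_pow, ← Finset.card_range n,
      ← Finset.prod_const, Finset.card_range, ← Finset.prod_mul_distrib]
    refine Finset.prod_congr rfl fun i hi => ?_
    have hi := Finset.mem_range.1 hi
    have : ((n - 1 - i : ℕ) : ℤ) = n - 1 - i := by omega
    rw [this]
    simp only [add_comp, mul_comp, X_comp, C_comp, C_add, C_sub, C_neg, C_1, neg_comp, one_comp]
    ring
  -- The `k`-th Taylor coefficient is the Hasse derivative at `n + 1`, which is then expanded in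
  -- powers of `n + 1`. As `n + k` is odd, its leading term is the negative of the other side, hence
  -- the factor `2`.
  have hk := congrArg (fun q => coeff q k) hsym
  simp only [taylor_coeff, coeff_C_mul] at hk
  obtain ⟨e, he⟩ := (hasseDeriv k (G.comp (C (-1) * X))).exists_eval_eq_add_pow_four ((n : ℤ) + 1)
  rw [hk] at he
  simp only [hasseDeriv_coeff, hco, zero_add, Nat.choose_self, Nat.cast_one, one_mul] at he
  have hsign : (-1 : ℤ) ^ n = -(-1) ^ k := by
    have h1 := hnk.neg_one_pow (α := ℤ)
    rw [pow_add] at h1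
    rcases neg_one_pow_eq_or ℤ k with h | h <;> rw [h] at h1 ⊢ <;> linarith
  have hsq : (-1 : ℤ) ^ k * (-1) ^ k = 1 := by rw [← mul_pow]; simp
  refine ⟨-(-1) ^ k * e, ?_⟩
  rw [hsign, add_comm 1 k, add_comm 2 k, add_comm 3 k, pow_succ (-1 : ℤ) k, pow_add (-1 : ℤ) k 2,
    pow_add (-1 : ℤ) k 3] at he
  generalize (-1 : ℤ) ^ k = σ at he hsq ⊢
  linear_combination (-σ) * he - (2 * G.coeff k - ((k + 1).choose k : ℤ) * G.coeff (k + 1) * (n + 1) +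
    ((k + 2).choose k : ℤ) * G.coeff (k + 2) * (n + 1) ^ 2 -
    ((k + 3).choose k : ℤ) * G.coeff (k + 3) * (n + 1) ^ 3) * hsq

/-- The factor `k + 1` occurs in `(k + 1) ⋯ (k + i)`, and `i!` is prime to `p`. -/
theorem Nat.Prime.dvd_choose_add_of_dvd_succ {p k i : ℕ} (hp : p.Prime) (hi : 1 ≤ i) (hip : i < p)
    (hk : p ∣ k + 1) : p ∣ (k + i).choose k := by
  have h1 : p ∣ (k + 1).ascFactorial i := by
    obtain ⟨j, rfl⟩ : ∃ j, i = j + 1 := ⟨i - 1, by omega⟩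
    rw [add_comm j, ← Nat.ascFactorial_mul_ascFactorial]
    exact Dvd.dvd.mul_right (by simpa [Nat.ascFactorial] using hk) _
  rw [Nat.ascFactorial_eq_factorial_mul_choose] at h1
  rw [Nat.choose_symm_add]
  refine (hp.dvd_or_dvd h1).resolve_left fun h => ?_
  exact absurd (hp.dvd_factorial.1 h) (not_le.2 hip)

theorem IsRegularPrime.not_pow_four_dvd_coeff {p a k : ℕ} (hp : IsRegularPrime p)
    (hp5 : 5 ≤ p) (ha : 1 ≤ a) (hap : a < p) (hak : a ≤ k + 2) (hk : k + 1 ≤ a * p) :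
    ¬ (p : ℤ) ^ 4 ∣ (∏ i ∈ Finset.range (a * p - 1), (X + C ((i : ℤ) + 1))).coeff k := by
  have hodd : Odd p := hp.1.odd_of_ne_two (by omega)
  have hpZ : Prime (p : ℤ) := Nat.prime_iff_prime_int.1 hp.1
  have hp0 : (p : ℤ) ≠ 0 := hpZ.ne_zero
  have hap1 : 1 ≤ a * p := Nat.mul_pos ha (by omega)
  have hG : ∀ l, (∏ i ∈ Finset.range (a * p - 1), (X + C ((i : ℤ) + 1))).coeff l =
      (∏ i ∈ Finset.range (a * p), (X + C (i : ℤ))).coeff (l + 1) := fun l => by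
    have := X_mul_prod_range_X_add_C_succ (a * p - 1)
    rw [Nat.sub_add_cancel hap1] at this
    rw [← this, coeff_X_mul]
  have hpar : (a * p) % 2 = a % 2 := by
    obtain ⟨t, rfl⟩ := hodd
    rw [show a * (2 * t + 1) = a + 2 * (a * t) by ring]; omega
  have hN : (((a * p - 1 : ℕ) : ℤ) + 1) = a * p := by
    rw [Nat.cast_sub hap1]; push_cast; ring
  rcases Nat.even_or_odd (k + 1 + a) with hev | hev
  · intro hd
    refine hp.not_sq_dvd_coeff_prod_range_mul hp5 ha hap (j := k + 1) ?_ hk ?_ ?_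
    · rw [Nat.even_iff] at hev; omega
    · rw [Nat.even_iff] at hev ⊢; omega
    · rw [← hG]
      exact (pow_dvd_pow _ (by norm_num)).trans hd
  · rw [Nat.odd_iff] at hev
    have hu : ¬ (p : ℤ) ^ 2 ∣
        (∏ i ∈ Finset.range (a * p - 1), (X + C ((i : ℤ) + 1))).coeff (k + 1) := by
      rw [hG]
      refine hp.not_sq_dvd_coeff_prod_range_mul hp5 ha hap (by omega) (by omega) ?_
      rw [Nat.even_iff]; omega
    -- The index `k + 2` again has the bad parity, so the symmetry makes twice this coefficient a
    -- multiple of `a * p`.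
    have hv : (p : ℤ) ∣
        (∏ i ∈ Finset.range (a * p - 1), (X + C ((i : ℤ) + 1))).coeff (k + 2) := by
      obtain ⟨e, he⟩ := exists_two_mul_coeff_prod_range_X_add_C_succ (n := a * p - 1) (k := k + 2)
        (by rw [Nat.odd_iff]; omega)
      rw [hN] at he
      have h2 : (p : ℤ) ∣ 2 *
          (∏ i ∈ Finset.range (a * p - 1), (X + C ((i : ℤ) + 1))).coeff (k + 2) := by
        rw [he]
        refine dvd_add (dvd_add (dvd_sub ?_ ?_) ?_) ?_
        · exact (dvd_mul_left _ _).mul_left _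
        · exact ((dvd_mul_left _ _).pow two_ne_zero).mul_left _
        · exact ((dvd_mul_left _ _).pow three_ne_zero).mul_left _
        · exact ((dvd_mul_left _ _).pow four_ne_zero).mul_right _
      refine (hpZ.dvd_or_dvd h2).resolve_left fun h => ?_
      have : p ∣ 2 := by exact_mod_cast h
      have := Nat.le_of_dvd two_pos this
      omega
    obtain ⟨e, he⟩ := exists_two_mul_coeff_prod_range_X_add_C_succ (n := a * p - 1) (k := k)
        (by rw [Nat.odd_iff]; omega)
    rw [hN] at he
    revert he hu hv
    generalize (∏ i ∈ Finset.range (a * p - 1), (X + C ((i : ℤ) + 1))).coeff k = g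
    generalize (∏ i ∈ Finset.range (a * p - 1), (X + C ((i : ℤ) + 1))).coeff (k + 1) = u
    generalize (∏ i ∈ Finset.range (a * p - 1), (X + C ((i : ℤ) + 1))).coeff (k + 2) = v
    generalize (∏ i ∈ Finset.range (a * p - 1), (X + C ((i : ℤ) + 1))).coeff (k + 3) = w
    rintro hu ⟨v, rfl⟩ he ⟨g, rfl⟩
    have hcop : ∀ t : ℕ, 0 < t → t < p → IsCoprime ((p : ℤ) ^ 2) (t : ℤ) := fun t h0 ht => by
      refine IsCoprime.pow_left ((Nat.isCoprime_iff_coprime).2 ?_)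
      exact (hp.1.coprime_iff_not_dvd).2 fun h => absurd (Nat.le_of_dvd h0 h) (not_le.2 ht)
    rw [Nat.choose_succ_self_right] at he
    by_cases hpk : p ∣ k + 1
    -- The leading term gains a factor `p` from `k + 1 = p * t`, but `t ≤ a < p` allows no more. The
    -- later binomials gain one as well, so all the other terms are divisible by `p ^ 4`.
    · obtain ⟨c2, hc2⟩ := hp.1.dvd_choose_add_of_dvd_succ (i := 2) (by norm_num) (by omega) hpk
      obtain ⟨c3, hc3⟩ := hp.1.dvd_choose_add_of_dvd_succ (i := 3) (by norm_num) (by omega) hpk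
      obtain ⟨t, ht⟩ := hpk
      rw [hc2, hc3, ht] at he
      push_cast at he
      have ht0 : 0 < t := Nat.pos_of_ne_zero (by rintro rfl; simp at ht)
      have hta : t ≤ a := by
        have : p * t ≤ p * a := by rw [← ht, mul_comm p a]; exact hk
        exact Nat.le_of_mul_le_mul_left this (by omega)
      refine hu ((hcop t ht0 (by omega)).dvd_of_dvd_mul_left
        ((hcop a ha hap).dvd_of_dvd_mul_left ?_))
      refine ⟨2 * g + c2 * v * a ^ 2 - c3 * w * a ^ 3 - a ^ 4 * e, ?_⟩
      apply mul_left_cancel₀ (pow_ne_zero 2 hp0)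
      linear_combination -he
    -- Here the comparison modulo `p ^ 3` suffices.
    · have hck : IsCoprime ((p : ℤ) ^ 2) ((k + 1 : ℕ) : ℤ) :=
        IsCoprime.pow_left ((Nat.isCoprime_iff_coprime).2 ((hp.1.coprime_iff_not_dvd).2 hpk))
      refine hu (hck.dvd_of_dvd_mul_left ((hcop a ha hap).dvd_of_dvd_mul_left ?_))
      refine ⟨2 * p * g + ((k + 2).choose k : ℤ) * v * a ^ 2 - ((k + 3).choose k : ℤ) * w * a ^ 3
        - p * a ^ 4 * e, ?_⟩
      apply mul_left_cancel₀ hp0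
      linear_combination -he

end

/-! ### From coefficients to harmonic sums -/

section
open Polynomial

theorem factorial_mul_harmonicEsymm (n k : ℕ) :
    (n.factorial : ℚ) * harmonicEsymm n k =
      ((∏ i ∈ Finset.range n, (X + C ((i : ℤ) + 1))).coeff k : ℤ) := by
  have h1 : harmonicEsymm n k =
      (∏ i ∈ Finset.Icc 1 n, (1 + C (1 / (i : ℚ)) * X)).coeff k := by
    rw [Finset.prod_one_add, finsetSum_coeff, harmonicEsymm, Finset.powersetCard_eq_filter,
      Finset.sum_filter]
    refine Finset.sum_congr rfl fun s _ => ?_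
    rw [Finset.prod_mul_distrib, Finset.prod_const, ← map_prod, coeff_C_mul_X_pow]
    simp only [eq_comm]
  have h2 : ((∏ i ∈ Finset.range n, (X + C ((i : ℤ) + 1))).coeff k : ℚ) =
      (∏ i ∈ Finset.range n, (X + C ((i : ℚ) + 1))).coeff k := by
    rw [← eq_intCast (Int.castRingHom ℚ), ← coeff_map, Polynomial.map_prod]
    simp
  have h3 : ∏ i ∈ Finset.Icc 1 n, (1 + C (1 / (i : ℚ)) * X) =
      ∏ i ∈ Finset.range n, (1 + C (1 / ((i + 1 : ℕ) : ℚ)) * X) := by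
    refine Finset.prod_nbij' (fun i => i - 1) (fun i => i + 1) ?_ ?_ ?_ ?_ ?_
    · intro i hi; simp at hi ⊢; omega
    · intro i hi; simp at hi ⊢; omega
    · intro i hi; simp at hi ⊢; omega
    · intro i hi; simp
    · intro i hi
      rw [Nat.sub_add_cancel (Finset.mem_Icc.1 hi).1]
  rw [h1, h2, h3, ← coeff_C_mul, ← Finset.prod_range_add_one_eq_factorial, Nat.cast_prod, map_prod,
    ← Finset.prod_mul_distrib]
  congr 1
  refine Finset.prod_congr rfl fun i _ => ?_
  have hi0 : ((i + 1 : ℕ) : ℚ) ≠ 0 := by exact_mod_cast i.succ_ne_zero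
  rw [mul_add, mul_one, ← mul_assoc, ← C_mul, mul_one_div_cancel hi0, C_1, one_mul, add_comm]
  push_cast
  rfl

end

theorem padicValNat_factorial_mul_sub_one {p a : ℕ} [Fact p.Prime] (ha : 1 ≤ a) (hap : a < p) :
    padicValNat p (a * p - 1).factorial = a - 1 := by
  have hp := (Fact.out : p.Prime)
  obtain ⟨b, rfl⟩ : ∃ b, a = b + 1 := ⟨a - 1, by omega⟩
  have e : (b + 1) * p - 1 = p * b + (p - 1) := by
    have := hp.one_le
    rw [add_mul, one_mul, mul_comm b p]; omega
  rw [e, padicValNat_factorial_mul_add _ (by omega), padicValNat_factorial_mul,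
    padicValNat.eq_zero_of_not_dvd]
  · omega
  · rw [hp.dvd_factorial]; omega

theorem padicValRat_harmonicEsymm_le {p a k : ℕ} (hp : IsRegularPrime p) (hp5 : 5 ≤ p)
    (ha : 1 ≤ a) (hap : a < p) (hak : a ≤ k + 2) (hk : k + 1 ≤ a * p) :
    padicValRat p (harmonicEsymm (a * p - 1) k) ≤ 4 - (a : ℤ) := by
  have : Fact p.Prime := ⟨hp.1⟩
  have hd := hp.not_pow_four_dvd_coeff hp5 ha hap hak hk
  have hH := factorial_mul_harmonicEsymm (a * p - 1) k
  revert hd hH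
  generalize (∏ i ∈ Finset.range (a * p - 1),
    (Polynomial.X + Polynomial.C ((i : ℤ) + 1))).coeff k = g
  intro hd hH
  have hg : g ≠ 0 := by rintro rfl; exact hd (dvd_zero _)
  have hf : ((a * p - 1).factorial : ℚ) ≠ 0 := by exact_mod_cast Nat.factorial_ne_zero _
  have hg3 : padicValInt p g ≤ 3 := by
    rw [padicValInt_dvd_iff] at hd
    omega
  have hgQ : (g : ℚ) ≠ 0 := by exact_mod_cast hg
  rw [eq_div_of_mul_eq hf ((mul_comm _ _).trans hH), padicValRat.div hgQ hf, padicValRat.of_int,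
    padicValRat.of_nat, padicValNat_factorial_mul_sub_one ha hap]
  omega

theorem corollary1p3 (p : ℕ) (hp : IsRegularPrime p) (hp5 : 5 ≤ p) (a k : ℕ)
    (ha : 1 ≤ a) (hap : a ≤ p - 1) (hk : max 1 (a - 2) ≤ k) (hkap : k ≤ a * p - 1) :
    padicValRat p (harmonicEsymm (a * p - 1) k) ≤ 4 - (a : ℤ) ∧
      (5 ≤ a → (padicValRat p (harmonicEsymm (a * p - 1) k) : ℝ) <
        -(1 / (2 * Real.log p)) * Real.log ((a : ℝ) * p - 1)) := by
  have hap1 : 1 ≤ a * p := Nat.mul_pos ha (by omega)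
  have hle : padicValRat p (harmonicEsymm (a * p - 1) k) ≤ 4 - (a : ℤ) :=
    padicValRat_harmonicEsymm_le hp hp5 ha (by omega) (by omega) (by omega)
  refine ⟨hle, fun ha5 => ?_⟩
  have hp5R : (5 : ℝ) ≤ p := by exact_mod_cast hp5
  have haR : (5 : ℝ) ≤ a := by exact_mod_cast ha5
  have hapR : (a : ℝ) ≤ p := by exact_mod_cast (by omega : a ≤ p)
  have hlog : 0 < Real.log p := Real.log_pos (by linarith)
  -- As `a * p - 1 < p ^ 2`, the right-hand side of the goal exceeds `-1`, while `4 - a ≤ -1`.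
  have hlt : Real.log ((a : ℝ) * p - 1) < 2 * Real.log p := by
    rw [← Nat.cast_two, ← Real.log_pow]
    exact Real.log_lt_log (by nlinarith) (by nlinarith)
  have h1 : (padicValRat p (harmonicEsymm (a * p - 1) k) : ℝ) ≤ -1 := by
    exact_mod_cast (by omega : padicValRat p (harmonicEsymm (a * p - 1) k) ≤ -1)
  refine h1.trans_lt ?_
  rw [neg_mul, neg_lt_neg_iff, one_div_mul_eq_div, div_lt_one (by positivity)]
  exact hlt
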